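/- **Theorem (Closed-form Euler matching at good primes).** Let $E_0: y^2=x^3+8x$ (the elliptic curve over $\mathbb{Q}$ with Cremona label 256b2). For a prime $p$ put $a_p=p+1-\#E_0(\mathbb{F}_p)$, where $\#E_0(\mathbb{F}_p)$ is the number of projective points of the reduced equation $y^2=x^3+8x$ over $\mathbb{F}_p$ (so $a_2=0$; these are the prime coefficients of $L(E_0,s)$, i.e. the Hecke eigenvalues of the weight-$2$ newform attached to $E_0$). Let $$A(z;\lambda)=z\,I_2-L_S-\lambda z^{-1/2}V,\qquad L_S=\begin{pmatrix}1&0\\0&-1\end{pmatrix},\quad V=\begin{pmatrix}1&1\\-1&1\end{pmatrix},\qquad R(z;\lambda)=A(z;\lambda)^{-1},$$ with the principal branch of $z^{-1/2}$ (with $\arg z=\pi$ on the negative axis). On the double cover $z=u^2$, $u\neq 0$, write $A_u(\lambda)=u^2I_2-L_S-\lambda u^{-1}V$, $R_u(\lambda)=A_u(\lambda)^{-1}$ and $$P(u;\lambda)=u^2\det A_u(\lambda)=u^6-u^2-2\lambda u^3+2\lambda^2,$$ so that $\{P=0\}$ is the affine spectral curve. A *basepoint* at $p$ is a pair $(u,\lambda)\in\mathbb{C}^2$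 with $u\ne0$, $A_u(\lambda)$ invertible, $\operatorname{tr}R_u(\lambda)=a_p$ and $\det R_u(\lambda)=p$; it is *real* if $u,\lambda\in\mathbb{R}$. Set $$\Delta_p=4p(p+1)-a_p^2,\qquad w_p^{\pm}=\frac{a_p\pm\sqrt{\Delta_p}}{2p},\qquad \lambda_p^{\pm}=(w_p^{\pm})^{3/2}-\frac{a_p}{2p}(w_p^{\pm})^{1/2}$$ (principal branch). Then: (a) $\Delta_p>0$ for every prime $p$. (b) For every prime $p$, $w_p^+>0$ and $w_p^-<0$. The real basepoints at $p$ are exactly $(\sqrt{w_p^+},\lambda_p^+)$ and $(-\sqrt{w_p^+},-\lambda_p^+)$. The basepoints with $u^2=w_p^-$ are exactly $\pm\bigl((w_p^-)^{1/2},\lambda_p^-\bigr)$, and they are not real. Every real basepoint lies off the spectral curve ($P\ne0$), and $P(\sqrt{w_p^+};\lambda_p^+)=P(-\sqrt{w_p^+};-\lambda_p^+)=w_p^+/p$. (c) For every prime $p\neq2$ the matrix $A(w_p^+;\lambda_p^+)$ is invertible and $$\det\bigl(I_2-p^{-s}R(w_p^{+};\lambda_p^{+})\bigr)=1-a_p\,p^{-s}+p^{1-2s}=L_p(E_0,s)^{-1},$$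 as an identity of polynomials in $p^{-s}$ and hence for all $s\in\mathbb{C}$, where $L_p(E_0,s)$ is the local Euler factor of $E_0$ at $p$. The same holds with $(w_p^-,\lambda_p^-)$ in place of $(w_p^+,\lambda_p^+)$. -/

import Mathlib

noncomputable section

open Polynomial

namespace EulerMatching

/-- The curve `E₀ : y² = x³ + 8x`, by its (globally minimal) integral Weierstrass equation. -/
def E0 : WeierstrassCurve ℤ := ⟨0, 0, 0, 8, 0⟩

/-- `a_p = p + 1 - #E₀(𝔽_p)`, where `#E₀(𝔽_p)` is the number of projective points of the reduced
equation: its affine solutions and the point at infinity. At the additive prime `2` the singular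
point is counted too, which gives `a_2 = 0`. -/
def a (p : ℕ) : ℤ :=
  (p : ℤ) + 1 - ((Nat.card {P : ZMod p × ZMod p //
    (E0.map (Int.castRingHom (ZMod p))).toAffine.Equation P.1 P.2} : ℤ) + 1)

/-- The polynomial `L_p(E₀, T)` with `L_p(E₀, s)⁻¹ = L_p(E₀, p⁻ˢ)`: Mathlib's local polynomial of
the curve `E₀` over the local field `ℚ_p`. -/
def localPoly (p : ℕ) [Fact p.Prime] : ℂ[X] :=
  ((E0.map (Int.castRingHom ℚ_[p])).localPolynomial ℤ_[p]).map (Int.castRingHom ℂ)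

/-- The local Euler factor `L_p(E₀, s)`. -/
def localLFactor (p : ℕ) [Fact p.Prime] (s : ℂ) : ℂ :=
  ((localPoly p).eval ((p : ℂ) ^ (-s)))⁻¹

def LS : Matrix (Fin 2) (Fin 2) ℂ := !![1, 0; 0, -1]

def V : Matrix (Fin 2) (Fin 2) ℂ := !![1, 1; -1, 1]

/-- The pencil `A(z; λ) = z - L_S - λ z^{-1/2} V`, with the principal branch of `z^{-1/2}`. -/
def pencil (z lam : ℂ) : Matrix (Fin 2) (Fin 2) ℂ :=
  z • (1 : Matrix (Fin 2) (Fin 2) ℂ) - LS - (lam * z ^ (-(1 / 2) : ℂ)) • V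

/-- The resolvent `R(z; λ) = A(z; λ)⁻¹`. -/
def resolvent (z lam : ℂ) : Matrix (Fin 2) (Fin 2) ℂ := (pencil z lam)⁻¹

/-- The pencil on the double cover `z = u²`, where `z^{1/2}` is read as `u`. -/
def pencilU (u lam : ℂ) : Matrix (Fin 2) (Fin 2) ℂ :=
  (u ^ 2) • (1 : Matrix (Fin 2) (Fin 2) ℂ) - LS - (lam * u⁻¹) • V

/-- The resolvent on the double cover `z = u²`. -/
def resolventU (u lam : ℂ) : Matrix (Fin 2) (Fin 2) ℂ := (pencilU u lam)⁻¹

/-- The polynomial `P(u; λ)`, whose zero locus is the affine spectral curve. -/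
def P (u lam : ℂ) : ℂ := u ^ 6 - u ^ 2 - 2 * lam * u ^ 3 + 2 * lam ^ 2

/-- `P(u; λ) = u² det A(u²; λ)`. -/
theorem P_eq (u lam : ℂ) (hu : u ≠ 0) : P u lam = u ^ 2 * (pencilU u lam).det := by
  simp [P, pencilU, LS, V, Matrix.det_fin_two]
  field_simp
  ring

/-- `Δ_p = 4p(p+1) - a_p²`. -/
def disc (p : ℕ) : ℝ := 4 * p * (p + 1) - (a p : ℝ) ^ 2

def wPlus (p : ℕ) : ℝ := ((a p : ℝ) + √(disc p)) / (2 * p)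

def wMinus (p : ℕ) : ℝ := ((a p : ℝ) - √(disc p)) / (2 * p)

/-- `w^{3/2} - (a_p / (2p)) w^{1/2}` on the principal branch; its values at `w_p^±` are `λ_p^±`. -/
def lam (p : ℕ) (w : ℂ) : ℂ :=
  w ^ (3 / 2 : ℂ) - (a p : ℂ) / (2 * p) * w ^ (1 / 2 : ℂ)

/-- `(u, l)` is a basepoint at `p`: a solution, with `u ≠ 0` and invertible pencil, of the matching
system `tr R = a_p`, `det R = p`. -/
def IsBasepoint (p : ℕ) (x : ℂ × ℂ) : Prop :=
  x.1 ≠ 0 ∧ IsUnit (pencilU x.1 x.2).det ∧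
    (resolventU x.1 x.2).trace = (a p : ℂ) ∧ (resolventU x.1 x.2).det = (p : ℂ)

/-- Both coordinates are real. -/
def IsRealPoint (x : ℂ × ℂ) : Prop := x.1.im = 0 ∧ x.2.im = 0

end EulerMatching

end

/-! For 2 × 2 matrices `tr R = tr A / det A` and `det R = 1 / det A`, so the matching system says
`det A = 1/p` and `tr A = a_p/p`. The trace is `2(u² - λ/u)`, which fixes `λ = u(u² - a_p/(2p))`;
the determinant then becomes a quadratic in `u²` with roots `w_p^±`. Counting at most two `y` for
each `x` gives `|a_p| ≤ p`, enough for `Δ_p > a_p²`; Hasse's bound is not needed. Hence the roots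
have opposite signs, and only `w_p^+` has real square roots.

The Euler factor is `1 - (tr R) T + (det R) T²`. Identifying it with `localPolynomial`, which refers
to a chosen minimal model, requires independence of the model: when `2` is a unit, equations of unit
discriminant differ by an integral change of variables (`exists_map_eq_of_isUnit_Δ`), so their
reductions have equally many points. -/

namespace WeierstrassCurve

/-! ### Integrality of changes of variables -/

section LocalField

variable {R : Type*} [CommRing R] {K : Type*} [Field K] [Algebra R K] [IsFractionRing R K]

/-- A change of variables between two integral Weierstrass equations with unit discriminants is
itself integral, provided that `2` is invertible. -/
theorem VariableChange.exists_map_eq_of_isUnit_Δ [IsDomain R] [IsIntegrallyClosed R]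
    (h2 : IsUnit (2 : R)) {W W' : WeierstrassCurve R} (hW : IsUnit W.Δ) (hW' : IsUnit W'.Δ)
    {C : VariableChange K}
    (hC : C • W.map (algebraMap R K) = W'.map (algebraMap R K)) :
    ∃ C₀ : VariableChange R, C₀.map (algebraMap R K) = C := by
  have hΔ : (algebraMap R K) W'.Δ = (C.u⁻¹ : K) ^ 12 * algebraMap R K W.Δ := by
    have h := congrArg WeierstrassCurve.Δ hC
    rw [variableChange_Δ, map_Δ, map_Δ] at h
    simpa using h.symm
  have hu0 : (C.u : K) ≠ 0 := C.u.ne_zero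
  obtain ⟨d, hd⟩ := hW
  obtain ⟨d', hd'⟩ := hW'
  have key : ∀ e : Rˣ, algebraMap R K (e : R) * algebraMap R K ((e⁻¹ : Rˣ) : R) = 1 := fun e ↦ by
    rw [← map_mul, Units.mul_inv, map_one]
  rw [← hd, ← hd'] at hΔ
  have hu : (C.u : K) ^ 12 = algebraMap R K (d * (d'⁻¹ : Rˣ)) := by
    rw [map_mul]
    have := key d'
    field_simp at hΔ
    linear_combination (algebraMap R K (d'⁻¹ : Rˣ)) * hΔ - (C.u : K) ^ 12 * this
  have hu' : (C.u⁻¹ : K) ^ 12 = algebraMap R K (d' * (d⁻¹ : Rˣ)) := by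
    rw [map_mul]
    have := key d
    linear_combination - (algebraMap R K (d⁻¹ : Rˣ)) * hΔ - (C.u⁻¹ : K) ^ 12 * this
  -- `u¹²` is the ratio of the two unit discriminants, so `u` and `u⁻¹` are both integral over `R`.
  obtain ⟨u, hu⟩ := IsIntegrallyClosed.exists_algebraMap_eq_of_isIntegral_pow (n := 12)
    (by norm_num) (hu ▸ isIntegral_algebraMap : _root_.IsIntegral R ((C.u : K) ^ 12))
  obtain ⟨v, hv⟩ := IsIntegrallyClosed.exists_algebraMap_eq_of_isIntegral_pow (n := 12)
    (by norm_num) (hu' ▸ isIntegral_algebraMap : _root_.IsIntegral R ((C.u⁻¹ : K) ^ 12))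
  have hinj : Function.Injective (algebraMap R K) := IsFractionRing.injective R K
  have huv : u * v = 1 := hinj (by rw [map_mul, hu, hv, map_one, mul_inv_cancel₀ hu0])
  obtain ⟨c, hc⟩ := h2
  have hc2 : algebraMap R K ((c⁻¹ : Rˣ) : R) * 2 = 1 := by
    have := key c
    rw [hc, map_ofNat] at this
    linear_combination this
  set i := algebraMap R K ((c⁻¹ : Rˣ) : R) with hi
  obtain ⟨r, hr⟩ : ∃ r, algebraMap R K r = C.r := by
    have h6 := congrArg WeierstrassCurve.b₆ hC
    rw [variableChange_b₆] at h6
    simp only [map_b₂, map_b₄, map_b₆, Units.val_inv_eq_inv_val] at h6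
    field_simp at h6
    refine IsIntegrallyClosed.algebraMap_eq_of_integral (R := R) (K := K) ?_
    -- The transformation law of `b₆`, `u⁶b₆' = b₆ + 2rb₄ + r²b₂ + 4r³`, divided by `4`, is a monic
    -- equation for `r`.
    refine ⟨Polynomial.X ^ 3 + (Polynomial.C ((c⁻¹ : Rˣ) ^ 2 * W.b₂ : R) * Polynomial.X ^ 2 +
      Polynomial.C ((c⁻¹ : Rˣ) * W.b₄ : R) * Polynomial.X +
      Polynomial.C ((c⁻¹ : Rˣ) ^ 2 * (W.b₆ - u ^ 6 * W'.b₆) : R)), ?_, ?_⟩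
    · refine Polynomial.monic_X_pow_add ?_
      refine lt_of_le_of_lt (b := 2) ?_ (by norm_num)
      compute_degree
    · simp only [Polynomial.eval₂_add, Polynomial.eval₂_mul, Polynomial.eval₂_pow,
        Polynomial.eval₂_X, Polynomial.eval₂_C, map_mul, map_pow, map_sub, hu, ← hi,
        Polynomial.eval₂_sub]
      linear_combination i ^ 2 * h6 + (-C.r ^ 3 * (2 * i + 1) - C.r * algebraMap R K W.b₄ * i) * hc2
  obtain ⟨s, hs⟩ : ∃ s, algebraMap R K s = C.s := by
    have h1 := congrArg WeierstrassCurve.a₁ hC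
    rw [variableChange_a₁] at h1
    simp only [map_a₁, Units.val_inv_eq_inv_val] at h1
    field_simp at h1
    refine ⟨(c⁻¹ : Rˣ) * (u * W'.a₁ - W.a₁), ?_⟩
    simp only [map_mul, map_sub, hu, ← hi]
    linear_combination -i * h1 + C.s * hc2
  obtain ⟨t, ht⟩ : ∃ t, algebraMap R K t = C.t := by
    have h3 := congrArg WeierstrassCurve.a₃ hC
    rw [variableChange_a₃] at h3
    simp only [map_a₁, map_a₃, Units.val_inv_eq_inv_val] at h3
    field_simp at h3
    refine ⟨(c⁻¹ : Rˣ) * (u ^ 3 * W'.a₃ - W.a₃ - r * W.a₁), ?_⟩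
    simp only [map_mul, map_sub, map_pow, hu, hr, ← hi]
    linear_combination -i * h3 + C.t * hc2
  refine ⟨⟨⟨u, v, huv, by rw [mul_comm, huv]⟩, r, s, t⟩, ?_⟩
  ext <;> simp [hu, hr, hs, ht]

end LocalField

/-! ### Point counts under isomorphism -/

/-- The bijection between the affine points of `C • W` and those of `W`. -/
def Affine.variableChangeEquationEquiv {F : Type*} [Field F] (W : WeierstrassCurve F)
    (C : VariableChange F) :
    {Q : F × F // (C • W).toAffine.Equation Q.1 Q.2} ≃ {Q : F × F // W.toAffine.Equation Q.1 Q.2} :=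
  Equiv.subtypeEquiv
    { toFun := fun Q ↦ (C.u ^ 2 * Q.1 + C.r, C.u ^ 3 * Q.2 + C.u ^ 2 * C.s * Q.1 + C.t)
      invFun := fun Q ↦ ((C.u⁻¹ : F) ^ 2 * (Q.1 - C.r),
        (C.u⁻¹ : F) ^ 3 * (Q.2 - C.s * (Q.1 - C.r) - C.t))
      left_inv := fun Q ↦ by
        have := C.u.ne_zero
        ext
        · simp [field]
        · simp [field]
          ring
      right_inv := fun Q ↦ by
        have := C.u.ne_zero
        ext
        · simp [field]
        · simp [field]
          ring }
    (fun Q ↦ by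
      have hu := C.u.ne_zero
      have h6 : (C.u : F) ^ 6 ≠ 0 := pow_ne_zero _ hu
      rw [Affine.equation_iff', Affine.equation_iff', ← mul_eq_zero_iff_left h6]
      simp only [variableChange_def, Units.val_inv_eq_inv_val, Equiv.coe_fn_mk]
      refine Eq.congr_left ?_
      field_simp
      ring)

/-- A ring isomorphism carries the affine points of a Weierstrass curve to those of its image. -/
def Affine.mapEquationEquiv {R S : Type*} [CommRing R] [CommRing S] (W : WeierstrassCurve R)
    (e : R ≃+* S) :
    {Q : R × R // W.toAffine.Equation Q.1 Q.2} ≃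
      {Q : S × S // (W.map (e : R →+* S)).toAffine.Equation Q.1 Q.2} :=
  Equiv.subtypeEquiv (e.toEquiv.prodCongr e.toEquiv)
    (fun Q ↦ (Affine.map_equation W (f := (e : R →+* S)) e.injective Q.1 Q.2).symm)

/-- Over a finite field an elliptic curve has one more point than its affine equation. -/
theorem Affine.natCard_point_eq {F : Type*} [Field F] [Finite F] (W : WeierstrassCurve F)
    [W.IsElliptic] :
    Nat.card W.toAffine.Point = Nat.card {Q : F × F // W.toAffine.Equation Q.1 Q.2} + 1 := by
  rw [← Finite.card_option]
  refine Nat.card_congr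
    { toFun := fun Q ↦ match Q with
        | .zero => none
        | .some x y h => some ⟨(x, y), h.1⟩
      invFun := fun Q ↦ match Q with
        | none => .zero
        | some ⟨(x, y), h⟩ => .some x y (Affine.equation_iff_nonsingular.mp h)
      left_inv := fun Q ↦ by cases Q <;> rfl
      right_inv := fun Q ↦ by rcases Q with _ | ⟨⟨x, y⟩, h⟩ <;> rfl }

/-! ### Good reduction and the local polynomial -/

section GoodReduction

open IsDiscreteValuationRing IsDedekindDomain.HeightOneSpectrum Polynomial

variable (R : Type*) [CommRing R] [IsDomain R] [IsDiscreteValuationRing R]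
  {K : Type*} [Field K] [Algebra R K] [IsFractionRing R K]

theorem valuation_eq_one_iff_isUnit (x : R) :
    valuation K (maximalIdeal R) (algebraMap R K x) = 1 ↔ IsUnit x := by
  have h := valuation_lt_one_iff_mem (K := K) (maximalIdeal R) x
  have h' := valuation_le_one (K := K) (maximalIdeal R) x
  have hm : x ∈ (maximalIdeal R).asIdeal ↔ ¬ IsUnit x := IsLocalRing.mem_maximalIdeal x
  rw [hm] at h
  rcases h'.lt_or_eq with h1 | h1
  · exact ⟨fun h2 ↦ absurd h2 h1.ne, fun h2 ↦ absurd h2 (h.mp h1)⟩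
  · exact ⟨fun h2 ↦ by_contra fun h3 ↦ (h.mpr h3).ne h1, fun _ ↦ h1⟩

/-- The minimal equation of a curve with an integral equation of unit discriminant has good
reduction. -/
theorem hasGoodReduction_minimal_of_isUnit_Δ {W : WeierstrassCurve R} (hW : IsUnit W.Δ) :
    ((W.map (algebraMap R K)).minimal R).HasGoodReduction R := by
  set C := ((W.map (algebraMap R K)).exists_isMinimal R).choose with hC
  have hmin : (W.map (algebraMap R K)).minimal R = C • W.map (algebraMap R K) := rfl
  refine ⟨le_antisymm ?_ ?_⟩
  · obtain ⟨x, hx⟩ := Δ_integral_of_isIntegral R ((W.map (algebraMap R K)).minimal R)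
    rw [← hx]
    exact valuation_le_one _ _
  · have hint : IsIntegral R (W.map (algebraMap R K)) := ⟨W, rfl⟩
    have hval : valuation K (maximalIdeal R) (W.map (algebraMap R K)).Δ = 1 := by
      rw [map_Δ, valuation_eq_one_iff_isUnit]
      exact hW
    have hmax := (IsMinimal.val_Δ_maximal (R := R) (W := (W.map (algebraMap R K)).minimal R)).2
    have hsm : C⁻¹ • (W.map (algebraMap R K)).minimal R = W.map (algebraMap R K) := by
      rw [hmin, inv_smul_smul]
    have h := hmax (j := C⁻¹) (by simpa only [hsm] using hint)
    simp only [hsm, one_smul] at h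
    -- The given equation attains the largest possible valuation, `1`, so maximality forces the
    -- minimal one to attain it too.
    have h' : (valuation_Δ_aux R (W.map (algebraMap R K)) : WithZero (Multiplicative ℤ)) ≤
        valuation_Δ_aux R ((W.map (algebraMap R K)).minimal R) := by
      refine h ?_
      rw [← Subtype.coe_le_coe, valuation_Δ_aux_eq_of_isIntegral R (W.map (algebraMap R K)), hval]
      exact (valuation_Δ_aux R _).2
    rwa [valuation_Δ_aux_eq_of_isIntegral R (W.map (algebraMap R K)),
      valuation_Δ_aux_eq_of_isIntegral, hval] at h'

/-- In residue characteristic different from `2`, the local polynomial of a curve with an integral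
equation of unit discriminant can be computed from that equation. -/
theorem localPolynomial_map_of_isUnit_Δ [Finite (IsLocalRing.ResidueField R)]
    (h2 : IsUnit (2 : R)) {W : WeierstrassCurve R} (hW : IsUnit W.Δ) :
    (W.map (algebraMap R K)).localPolynomial R =
      1 - C ((Nat.card (IsLocalRing.ResidueField R) : ℤ) + 1 -
        (Nat.card {Q : IsLocalRing.ResidueField R × IsLocalRing.ResidueField R //
          (W.map (IsLocalRing.residue R)).toAffine.Equation Q.1 Q.2} + 1 : ℕ)) * X +
        C (Nat.card (IsLocalRing.ResidueField R) : ℤ) * X ^ 2 := by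
  have hgood := hasGoodReduction_minimal_of_isUnit_Δ R (K := K) hW
  set M := (W.map (algebraMap R K)).minimal R with hM
  have hmod : (integralModel R M).map (algebraMap R K) = M := baseChange_integralModel_eq R M
  have hunit : IsUnit (integralModel R M).Δ := by
    rw [← valuation_eq_one_iff_isUnit R (K := K), integralModel_Δ_eq]
    exact hgood.goodReduction
  obtain ⟨C₀, hC₀⟩ := VariableChange.exists_map_eq_of_isUnit_Δ h2 hW hunit
    (C := ((W.map (algebraMap R K)).exists_isMinimal R).choose) hmod.symm
  -- Descending the change of variables to `R` is what allows it to be reduced to the residue field.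
  have heq : integralModel R M = C₀ • W := by
    apply map_injective (IsFractionRing.injective R K)
    change (integralModel R M).map (algebraMap R K) = (C₀ • W).map (algebraMap R K)
    rw [hmod, ← map_variableChange, hC₀]
    rfl
  have hred : M.reduction R =
      C₀.map (IsLocalRing.residue R) • W.map (IsLocalRing.residue R) := by
    rw [map_variableChange, ← heq]
    rfl
  have hell : (M.reduction R).IsElliptic := hasGoodReduction_iff_isElliptic_reduction R |>.mp hgood
  have hcard : Nat.card (M.reduction R).toAffine.Point =
      Nat.card {Q : IsLocalRing.ResidueField R × IsLocalRing.ResidueField R //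
          (W.map (IsLocalRing.residue R)).toAffine.Equation Q.1 Q.2} + 1 := by
    rw [Affine.natCard_point_eq, hred,
      Nat.card_congr (Affine.variableChangeEquationEquiv _ _)]
  rw [localPolynomial, if_pos hgood, hcard]

end GoodReduction

end WeierstrassCurve

noncomputable section

namespace EulerMatching

open Polynomial

/-! ### The trivial bound on `a_p` and the signs of the branches -/

theorem natCard_equation_le (p : ℕ) [Fact p.Prime] :
    Nat.card {Q : ZMod p × ZMod p //
      (E0.map (Int.castRingHom (ZMod p))).toAffine.Equation Q.1 Q.2} ≤ 2 * p := by
  classical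
  rw [Nat.card_eq_fintype_card, Fintype.card_subtype]
  refine (Finset.card_le_mul_card_image (f := Prod.fst) _ 2 ?_).trans ?_
  · intro x _
    refine (Finset.card_le_card_of_injOn Prod.snd (t := (nthRoots 2 (x ^ 3 + 8 * x)).toFinset)
      ?_ ?_).trans ((Multiset.toFinset_card_le _).trans (card_nthRoots 2 _))
    · rintro ⟨x', y⟩ hQ
      simp only [Finset.coe_filter, Finset.mem_filter, Finset.mem_univ, true_and,
        Set.mem_ofPred_eq, WeierstrassCurve.Affine.equation_iff] at hQ
      obtain ⟨h, rfl⟩ := hQ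
      simpa [mem_nthRoots, E0] using h
    · rintro ⟨x₁, y₁⟩ h₁ ⟨x₂, y₂⟩ h₂ h
      simp only [Finset.coe_filter, Set.mem_ofPred_eq] at h₁ h₂
      exact Prod.ext (h₁.2.trans h₂.2.symm) h
  · gcongr
    exact (Finset.card_le_univ _).trans_eq (ZMod.card p)

/-- With `N` affine points, `a_p = p - N` and `0 ≤ N ≤ 2p`. -/
theorem sq_a_le (p : ℕ) [Fact p.Prime] : (a p : ℝ) ^ 2 ≤ (p : ℝ) ^ 2 := by
  have h : (Nat.card {Q : ZMod p × ZMod p //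
      (E0.map (Int.castRingHom (ZMod p))).toAffine.Equation Q.1 Q.2} : ℝ) ≤ 2 * p := by
    exact_mod_cast natCard_equation_le p
  have h0 : (0 : ℝ) ≤ (Nat.card {Q : ZMod p × ZMod p //
      (E0.map (Int.castRingHom (ZMod p))).toAffine.Equation Q.1 Q.2} : ℝ) := Nat.cast_nonneg _
  rw [a]
  push_cast
  refine sq_le_sq' ?_ ?_ <;> linarith

theorem natCast_pos (p : ℕ) [Fact p.Prime] : (0 : ℝ) < p :=
  Nat.cast_pos.mpr (Fact.out : p.Prime).pos

theorem disc_pos (p : ℕ) [Fact p.Prime] : 0 < disc p := by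
  have := sq_a_le p
  have := natCast_pos p
  rw [disc]
  nlinarith

/-- Since `a_p² ≤ p²`, one has `2a_p² < 4p(p+1)`. This decides the signs of both `w_p^±`. -/
theorem abs_a_lt_sqrt_disc (p : ℕ) [Fact p.Prime] : |(a p : ℝ)| < √(disc p) := by
  have := sq_a_le p
  have := natCast_pos p
  apply Real.lt_sqrt_of_sq_lt
  rw [sq_abs, disc]
  nlinarith

theorem wPlus_pos (p : ℕ) [Fact p.Prime] : 0 < wPlus p := by
  have := abs_lt.mp (abs_a_lt_sqrt_disc p)
  have := natCast_pos p
  exact div_pos (by linarith) (by linarith)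

theorem wMinus_neg (p : ℕ) [Fact p.Prime] : wMinus p < 0 := by
  have := abs_lt.mp (abs_a_lt_sqrt_disc p)
  have := natCast_pos p
  exact div_neg_of_neg_of_pos (by linarith) (by linarith)

/-- The right side is `det A = 1/p` after substituting `u² - λ/u = a_p/(2p)` and `z = u²`. -/
theorem eq_wPlus_or_wMinus_iff (p : ℕ) [Fact p.Prime] (z : ℂ) :
    (z = wPlus p ∨ z = wMinus p) ↔
      (z - (a p : ℂ) / (2 * p)) ^ 2 + ((a p : ℂ) / (2 * p)) ^ 2 - 1 = 1 / p := by
  have hp : (p : ℂ) ≠ 0 := by exact_mod_cast (natCast_pos p).ne'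
  have hd : ((√(disc p) : ℝ) : ℂ) ^ 2 = 4 * p * (p + 1) - (a p : ℂ) ^ 2 := by
    rw [← Complex.ofReal_pow, Real.sq_sqrt (disc_pos p).le, disc]
    push_cast
    ring
  have h : (z - (a p : ℂ) / (2 * p)) ^ 2 + ((a p : ℂ) / (2 * p)) ^ 2 - 1 - 1 / p =
      (z - wPlus p) * (z - wMinus p) := by
    rw [wPlus, wMinus]
    push_cast
    field_simp
    linear_combination hd
  rw [← sub_eq_zero (b := (1 : ℂ) / p), h, mul_eq_zero, sub_eq_zero, sub_eq_zero]

/-! ### Solving the matching system -/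

theorem det_pencilU (u l : ℂ) :
    (pencilU u l).det = (u ^ 2 - l * u⁻¹) ^ 2 + (l * u⁻¹) ^ 2 - 1 := by
  simp [pencilU, LS, V, Matrix.det_fin_two]
  ring

theorem trace_pencilU (u l : ℂ) : (pencilU u l).trace = 2 * (u ^ 2 - l * u⁻¹) := by
  simp [pencilU, LS, V, Matrix.trace_fin_two]
  ring

theorem trace_inv_fin_two (M : Matrix (Fin 2) (Fin 2) ℂ) : M⁻¹.trace = M.det⁻¹ * M.trace := by
  rw [Matrix.inv_def, Matrix.trace_smul, Matrix.adjugate_fin_two, Matrix.trace_fin_two,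
    Matrix.trace_fin_two]
  simp [add_comm]

theorem isBasepoint_iff (p : ℕ) [Fact p.Prime] (x : ℂ × ℂ) :
    IsBasepoint p x ↔ x.1 ≠ 0 ∧ (x.1 ^ 2 = wPlus p ∨ x.1 ^ 2 = wMinus p) ∧
      x.2 = x.1 * (x.1 ^ 2 - (a p : ℂ) / (2 * p)) := by
  obtain ⟨u, l⟩ := x
  have hp : (p : ℂ) ≠ 0 := by exact_mod_cast (natCast_pos p).ne'
  simp only [IsBasepoint, resolventU, trace_inv_fin_two, Matrix.det_nonsing_inv,
    Ring.inverse_eq_inv', isUnit_iff_ne_zero, eq_wPlus_or_wMinus_iff]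
  refine and_congr_right fun hu ↦ ?_
  have hl : l = u * (u ^ 2 - (a p : ℂ) / (2 * p)) ↔ u ^ 2 - l * u⁻¹ = (a p : ℂ) / (2 * p) := by
    constructor
    · rintro rfl
      field_simp
      ring
    · intro h
      rw [← h]
      field_simp
      ring
  rw [hl, trace_pencilU]
  constructor
  · rintro ⟨hd, ht, hdet⟩
    have hdet' : (pencilU u l).det = 1 / p := by rw [← hdet, one_div, inv_inv]
    rw [hdet] at ht
    have hm : u ^ 2 - l * u⁻¹ = (a p : ℂ) / (2 * p) := by
      rw [← ht]
      field_simp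
    refine ⟨?_, hm⟩
    rw [← hdet', det_pencilU, hm]
    linear_combination (u ^ 2 - a p / (2 * p) + l * u⁻¹) * hm
  · rintro ⟨hz, hm⟩
    have hdet : (pencilU u l).det = 1 / p := by
      rw [← hz, det_pencilU, hm]
      linear_combination (-u ^ 2 + a p / (2 * p) - l * u⁻¹) * hm
    rw [hdet, hm]
    refine ⟨by simpa using hp, ?_, by simp⟩
    field_simp

theorem cpow_half_sq (w : ℂ) : (w ^ (1 / 2 : ℂ)) ^ 2 = w := by
  rw [← Complex.cpow_nat_mul]
  norm_num

theorem lam_eq (p : ℕ) {w : ℂ} (hw : w ≠ 0) :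
    lam p w = w ^ (1 / 2 : ℂ) * ((w ^ (1 / 2 : ℂ)) ^ 2 - (a p : ℂ) / (2 * p)) := by
  rw [lam, show (3 / 2 : ℂ) = 1 + 1 / 2 by norm_num, Complex.cpow_add _ _ hw, Complex.cpow_one,
    cpow_half_sq]
  ring

/-- The basepoints over a branch `w = u²` are the two square roots of `w`, with the matching
value of the coupling. -/
theorem isBasepoint_and_sq_eq_iff (p : ℕ) [Fact p.Prime] {w : ℝ}
    (hw : w = wPlus p ∨ w = wMinus p) (x : ℂ × ℂ) :
    (IsBasepoint p x ∧ x.1 ^ 2 = w) ↔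
      x = ((w : ℂ) ^ (1 / 2 : ℂ), lam p w) ∨ x = (-(w : ℂ) ^ (1 / 2 : ℂ), -lam p w) := by
  have hw0 : (w : ℂ) ≠ 0 := by
    rcases hw with rfl | rfl
    · exact_mod_cast (wPlus_pos p).ne'
    · exact_mod_cast (wMinus_neg p).ne
  have hw' : (w : ℂ) = wPlus p ∨ (w : ℂ) = wMinus p := by exact_mod_cast hw
  have hne : (w : ℂ) ^ (1 / 2 : ℂ) ≠ 0 := fun h ↦ hw0 (by rw [← cpow_half_sq w, h]; norm_num)
  rw [isBasepoint_iff]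
  constructor
  · rintro ⟨⟨-, -, h2⟩, h1⟩
    rw [lam_eq p hw0, cpow_half_sq]
    rw [h1] at h2
    rcases sq_eq_sq_iff_eq_or_eq_neg.mp (h1.trans (cpow_half_sq w).symm) with h | h
    · exact .inl (Prod.ext h (by rw [h2, h]))
    · exact .inr (Prod.ext h (by rw [h2, h, neg_mul]))
  · rw [lam_eq p hw0]
    rintro (rfl | rfl)
    · simp only [cpow_half_sq]
      exact ⟨⟨hne, hw', trivial⟩, trivial⟩
    · simp only [neg_sq, cpow_half_sq]
      exact ⟨⟨neg_ne_zero.mpr hne, hw', by ring⟩, trivial⟩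

theorem cpow_half_of_nonneg {w : ℝ} (hw : 0 ≤ w) : (w : ℂ) ^ (1 / 2 : ℂ) = ((√w : ℝ) : ℂ) := by
  rw [Real.sqrt_eq_rpow, Complex.ofReal_cpow hw]
  norm_num

theorem not_isRealPoint_of_sq_eq_wMinus (p : ℕ) [Fact p.Prime] {x : ℂ × ℂ}
    (hx : x.1 ^ 2 = wMinus p) : ¬ IsRealPoint x := by
  rintro ⟨him, -⟩
  have h := congrArg Complex.re hx
  rw [sq, Complex.mul_re, him, Complex.ofReal_re] at h
  nlinarith [wMinus_neg p, sq_nonneg x.1.re]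

/-- Over `w_p^-` the square of `u` is negative; over `w_p^+` the coordinate `u` is real, and `λ` is
a real polynomial in `u`. -/
theorem isBasepoint_and_isRealPoint_iff (p : ℕ) [Fact p.Prime] (x : ℂ × ℂ) :
    (IsBasepoint p x ∧ IsRealPoint x) ↔ (IsBasepoint p x ∧ x.1 ^ 2 = wPlus p) := by
  refine and_congr_right fun hx ↦ ?_
  obtain ⟨-, h1, h2⟩ := (isBasepoint_iff p x).mp hx
  constructor
  · exact fun hr ↦ h1.resolve_right fun h ↦ not_isRealPoint_of_sq_eq_wMinus p h hr
  · intro h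
    have hre : ∃ t : ℝ, x.1 = t := by
      have hs : x.1 ^ 2 = ((√(wPlus p) : ℝ) : ℂ) ^ 2 := by
        rw [h, ← cpow_half_of_nonneg (wPlus_pos p).le, cpow_half_sq]
      rcases sq_eq_sq_iff_eq_or_eq_neg.mp hs with h | h
      · exact ⟨_, h⟩
      · exact ⟨-√(wPlus p), by rw [h]; push_cast; rfl⟩
    obtain ⟨t, ht⟩ := hre
    refine ⟨by rw [ht, Complex.ofReal_im], ?_⟩
    have : x.2 = ((t * (t ^ 2 - (a p : ℝ) / (2 * p)) : ℝ) : ℂ) := by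
      rw [h2, ht]
      push_cast
      rfl
    rw [this, Complex.ofReal_im]

theorem IsBasepoint.det_pencilU {p : ℕ} {x : ℂ × ℂ} (hx : IsBasepoint p x) :
    (pencilU x.1 x.2).det = (p : ℂ)⁻¹ := by
  have h := hx.2.2.2
  rw [resolventU, Matrix.det_nonsing_inv, Ring.inverse_eq_inv'] at h
  rw [← h, inv_inv]

theorem IsBasepoint.P_eq_div {p : ℕ} {x : ℂ × ℂ} (hx : IsBasepoint p x) :
    P x.1 x.2 = x.1 ^ 2 / p := by
  rw [P_eq _ _ hx.1, hx.det_pencilU, div_eq_mul_inv]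

/-- The principal `w^{-1/2}` is the inverse of the principal `w^{1/2}`, on the negative axis as
well, so both branches reduce to the double cover. -/
theorem pencil_eq_pencilU (w l : ℂ) : pencil w l = pencilU (w ^ (1 / 2 : ℂ)) l := by
  rw [pencil, pencilU, cpow_half_sq, Complex.cpow_neg]

/-! ### Characteristic polynomials and Euler factors -/

theorem charpolyRev_fin_two (M : Matrix (Fin 2) (Fin 2) ℂ) :
    M.charpolyRev = 1 - C M.trace * X + C M.det * X ^ 2 := by
  rw [Matrix.charpolyRev, Matrix.det_fin_two, Matrix.trace_fin_two, Matrix.det_fin_two]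
  simp
  ring

theorem eval_charpolyRev_eq_det (M : Matrix (Fin 2) (Fin 2) ℂ) (t : ℂ) :
    M.charpolyRev.eval t = (1 - t • M).det := by
  rw [charpolyRev_fin_two, Matrix.det_fin_two, Matrix.trace_fin_two, Matrix.det_fin_two]
  simp
  ring


theorem isUnit_two_padicInt {p : ℕ} [Fact p.Prime] (hp : p ≠ 2) : IsUnit (2 : ℤ_[p]) := by
  have h : Nat.Coprime p 2 := (Nat.coprime_primes Fact.out Nat.prime_two).mpr hp
  exact_mod_cast PadicInt.isUnit_iff.mpr (PadicInt.norm_natCast_eq_one_iff.mpr h)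

theorem localPoly_eq {p : ℕ} [Fact p.Prime] (hp : p ≠ 2) :
    localPoly p = 1 - C (a p : ℂ) * X + C (p : ℂ) * X ^ 2 := by
  have h2 := isUnit_two_padicInt hp
  have hΔ : IsUnit (E0.map (Int.castRingHom ℤ_[p])).Δ := by
    -- Only the prime `2` divides the discriminant, so the given equation has good reduction at
    -- every odd `p`.
    have : (E0.map (Int.castRingHom ℤ_[p])).Δ = -(2 ^ 15) := by
      rw [WeierstrassCurve.map_Δ]
      simp [E0, WeierstrassCurve.Δ, WeierstrassCurve.b₂, WeierstrassCurve.b₄,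
        WeierstrassCurve.b₆, WeierstrassCurve.b₈]
      norm_num
    rw [this]
    exact (h2.pow 15).neg
  let e : IsLocalRing.ResidueField ℤ_[p] ≃+* ZMod p := PadicInt.residueField
  have : Finite (IsLocalRing.ResidueField ℤ_[p]) := Finite.of_equiv _ e.symm.toEquiv
  have hq : Nat.card (IsLocalRing.ResidueField ℤ_[p]) = p := by
    rw [Nat.card_congr e.toEquiv, Nat.card_zmod]
  have hmap : E0.map (Int.castRingHom ℚ_[p]) =
      (E0.map (Int.castRingHom ℤ_[p])).map (algebraMap ℤ_[p] ℚ_[p]) := by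
    rw [WeierstrassCurve.map_map]
    congr 1
  have hred : ((E0.map (Int.castRingHom ℤ_[p])).map (IsLocalRing.residue ℤ_[p])).map
      (e : IsLocalRing.ResidueField ℤ_[p] →+* ZMod p) = E0.map (Int.castRingHom (ZMod p)) := by
    rw [WeierstrassCurve.map_map, WeierstrassCurve.map_map]
    congr 1
    exact RingHom.ext_int _ _
  have hcard := Nat.card_congr (WeierstrassCurve.Affine.mapEquationEquiv
    ((E0.map (Int.castRingHom ℤ_[p])).map (IsLocalRing.residue ℤ_[p])) e)
  rw [hred] at hcard
  rw [localPoly, hmap, WeierstrassCurve.localPolynomial_map_of_isUnit_Δ ℤ_[p] h2 hΔ, hq, hcard]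
  simp [a, Polynomial.map_sub, Polynomial.map_add, Polynomial.map_mul]

end EulerMatching
end

open EulerMatching in
theorem mainTheorem2 (p : ℕ) [Fact p.Prime] :
    -- (a)
    0 < disc p ∧
    -- (b)
    (0 < wPlus p ∧ wMinus p < 0 ∧
      {x : ℂ × ℂ | IsBasepoint p x ∧ IsRealPoint x} =
        {(((√(wPlus p) : ℝ) : ℂ), lam p (wPlus p)), (-((√(wPlus p) : ℝ) : ℂ), -lam p (wPlus p))} ∧
      {x : ℂ × ℂ | IsBasepoint p x ∧ x.1 ^ 2 = (wMinus p : ℂ)} =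
        {((wMinus p : ℂ) ^ (1 / 2 : ℂ), lam p (wMinus p)),
          (-(wMinus p : ℂ) ^ (1 / 2 : ℂ), -lam p (wMinus p))} ∧
      (∀ x : ℂ × ℂ, IsBasepoint p x → x.1 ^ 2 = (wMinus p : ℂ) → ¬ IsRealPoint x) ∧
      (∀ x : ℂ × ℂ, IsBasepoint p x → IsRealPoint x → P x.1 x.2 ≠ 0) ∧
      P ((√(wPlus p) : ℝ) : ℂ) (lam p (wPlus p)) = ((wPlus p / p : ℝ) : ℂ) ∧
      P (-((√(wPlus p) : ℝ) : ℂ)) (-lam p (wPlus p)) = ((wPlus p / p : ℝ) : ℂ)) ∧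
    -- (c), for both branches
    (p ≠ 2 → ∀ w : ℝ, w = wPlus p ∨ w = wMinus p →
      IsUnit (pencil w (lam p w)).det ∧
      (resolvent w (lam p w)).charpolyRev =
        1 - Polynomial.C (a p : ℂ) * Polynomial.X + Polynomial.C (p : ℂ) * Polynomial.X ^ 2 ∧
      (resolvent w (lam p w)).charpolyRev = localPoly p ∧
      ∀ s : ℂ,
        (1 - ((p : ℂ) ^ (-s)) • resolvent w (lam p w)).det =
            1 - (a p : ℂ) * (p : ℂ) ^ (-s) + (p : ℂ) ^ (1 - 2 * s) ∧
        (1 - ((p : ℂ) ^ (-s)) • resolvent w (lam p w)).det = (localLFactor p s)⁻¹) := by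

  have hw0 := cpow_half_of_nonneg (wPlus_pos p).le
  have hplus : ∀ x : ℂ × ℂ, (IsBasepoint p x ∧ IsRealPoint x) ↔
      x = (((√(wPlus p) : ℝ) : ℂ), lam p (wPlus p)) ∨
      x = (-((√(wPlus p) : ℝ) : ℂ), -lam p (wPlus p)) := fun x ↦ by
    rw [isBasepoint_and_isRealPoint_iff, isBasepoint_and_sq_eq_iff p (.inl rfl), hw0]
  have hP : ∀ x : ℂ × ℂ, IsBasepoint p x → IsRealPoint x →
      P x.1 x.2 = ((wPlus p / p : ℝ) : ℂ) := fun x hx hr ↦ by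
    rw [hx.P_eq_div, ((isBasepoint_and_isRealPoint_iff p x).mp ⟨hx, hr⟩).2]
    push_cast
    rfl
  refine ⟨disc_pos p, ⟨wPlus_pos p, wMinus_neg p, Set.ext hplus,
    Set.ext (isBasepoint_and_sq_eq_iff p (.inr rfl)),
    fun x _ h ↦ not_isRealPoint_of_sq_eq_wMinus p h, fun x hx hr ↦ ?_, ?_, ?_⟩, ?_⟩
  · rw [hP x hx hr]
    exact_mod_cast (div_pos (wPlus_pos p) (natCast_pos p)).ne'
  · have h := (hplus (((√(wPlus p) : ℝ) : ℂ), lam p (wPlus p))).mpr (.inl rfl)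
    exact hP (((√(wPlus p) : ℝ) : ℂ), lam p (wPlus p)) h.1 h.2
  · have h := (hplus (-((√(wPlus p) : ℝ) : ℂ), -lam p (wPlus p))).mpr (.inr rfl)
    exact hP (-((√(wPlus p) : ℝ) : ℂ), -lam p (wPlus p)) h.1 h.2
  · intro hp w hw
    -- The basepoint with `u = w^{1/2}` is the one that the principal-branch pencil sees.
    obtain ⟨-, hunit, htr, hdet⟩ := ((isBasepoint_and_sq_eq_iff p hw _).mpr (.inl rfl)).1
    have hR : resolvent w (lam p w) = resolventU ((w : ℂ) ^ (1 / 2 : ℂ)) (lam p w) := by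
      rw [EulerMatching.resolvent, resolventU, pencil_eq_pencilU]
    have hchar : (resolvent w (lam p w)).charpolyRev =
        1 - Polynomial.C (a p : ℂ) * Polynomial.X + Polynomial.C (p : ℂ) * Polynomial.X ^ 2 := by
      rw [charpolyRev_fin_two, hR, htr, hdet]
    have hloc := hchar.trans (localPoly_eq hp).symm
    refine ⟨by rwa [pencil_eq_pencilU], hchar, hloc, fun s ↦ ?_⟩
    have hp0 : (p : ℂ) ≠ 0 := by exact_mod_cast (natCast_pos p).ne'
    have hev := eval_charpolyRev_eq_det (resolvent w (lam p w)) ((p : ℂ) ^ (-s))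
    refine ⟨?_, by rw [← hev, hloc, localLFactor, inv_inv]⟩
    have hpow : (p : ℂ) ^ (1 - 2 * s) = p * ((p : ℂ) ^ (-s)) ^ 2 := by
      rw [sub_eq_add_neg, Complex.cpow_add _ _ hp0, Complex.cpow_one, ← Complex.cpow_nat_mul,
        Nat.cast_ofNat, mul_neg]
    rw [← hev, hchar, hpow, Polynomial.eval_add, Polynomial.eval_sub, Polynomial.eval_one,
      Polynomial.eval_C_mul, Polynomial.eval_C_mul, Polynomial.eval_X, Polynomial.eval_pow,
      Polynomial.eval_X]
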